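/- Let $x_1,\ldots,x_n$ ($n\ge 1$) be nonnegative real numbers, with indices taken cyclically, so that $x_{n+1}=x_1$. If $n\leq 8$, then $$\left(\sum_{i=1}^n x_i^3\right)^2\ \geq\ \left(\sum_{i=1}^n x_i^2\right)\left(\sum_{i=1}^n x_i^2x_{i+1}^2\right),$$ and equality occurs if and only if $x_1=x_2=\cdots=x_n$. Moreover, for every $n>8$ there exist nonnegative real numbers $x_1,\ldots,x_n$ for which this inequality fails. For $n=9$ an explicit counterexample is given by $$(x_1^2,\ldots,x_9^2)=(8.5,\ 9,\ 10,\ 11.5,\ 12,\ 11.5,\ 10,\ 9,\ 8.5),\qquad x_i\ge 0.$$ -/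

import Mathlib

open scoped BigOperators

/-! Write `A`, `B`, `C` for the sums of `x i ^ 2`, `x i ^ 3`, `x i ^ 2 * x (i + 1) ^ 2`. It suffices
to find one real `s` with `∑ x i ^ 2 * (x i - s) ^ 2 ≤ (∑ (x i ^ 2 - x (i + 1) ^ 2) ^ 2) / 2`:
expanding gives `C ≤ 2 * s * B - s ^ 2 * A`, hence `A * C ≤ B ^ 2 - (B - s * A) ^ 2`.

Repeating the last entry reduces `n ≤ 8` to `n = 8`. The left side ignores the order of the entries,
and the cyclic energy on the right is bounded below through the sorted values
(`cyclic_dirichlet_energy_ge`): the cycle crosses every threshold between consecutive ranks at least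
twice, and some step crosses any two neighbouring thresholds together. What remains is a polynomial
inequality in the smallest value and the seven gaps (`weighted_variance_add_gaps_le`). It holds with
a spare multiple of the sum of fourth powers of the gaps, which settles equality.

For `n > 8`, copies of the common end value of the nonagon example are inserted where its two ends
meet. -/

/-! ### Polynomial inequalities in the gaps -/

/-- This and the next two polynomials are the coefficients of `t ^ 2`, `t` and `1`, scaled by 100,
in `weighted_variance_add_gaps_le`. The linear forms with leading `8 * y1` or `-2 * y1` are `10 * (b
j - s)`. Each certificate is a sum of squares, with nonnegative weights, plus monomials with
positive coefficients. -/
theorem gap_quadratic_nonneg {y1 y2 y3 y4 y5 y6 y7 : ℝ} (h1 : 0 ≤ y1) (h2 : 0 ≤ y2) (h3 : 0 ≤ y3)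
    (h4 : 0 ≤ y4) (h5 : 0 ≤ y5) (h6 : 0 ≤ y6) (h7 : 0 ≤ y7) :
    0 ≤
      400 * (y1 ^ 2 + y1 * y2 + y2 ^ 2 + y2 * y3 + y3 ^ 2 + y3 * y4 + y4 ^ 2 + y4 * y5 + y5 ^ 2 +
        y5 * y6 + y6 ^ 2 + y6 * y7 + y7 ^ 2) -
      ((8 * y1 + 6 * y2 + 5 * y3 + 4 * y4 + 3 * y5 + 2 * y6 + y7) ^ 2 +
        (-2 * y1 + 6 * y2 + 5 * y3 + 4 * y4 + 3 * y5 + 2 * y6 + y7) ^ 2 +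
        (-2 * y1 - 4 * y2 + 5 * y3 + 4 * y4 + 3 * y5 + 2 * y6 + y7) ^ 2 +
        (-2 * y1 - 4 * y2 - 5 * y3 + 4 * y4 + 3 * y5 + 2 * y6 + y7) ^ 2 +
        (-2 * y1 - 4 * y2 - 5 * y3 - 6 * y4 + 3 * y5 + 2 * y6 + y7) ^ 2 +
        (-2 * y1 - 4 * y2 - 5 * y3 - 6 * y4 - 7 * y5 + 2 * y6 + y7) ^ 2 +
        (-2 * y1 - 4 * y2 - 5 * y3 - 6 * y4 - 7 * y5 - 8 * y6 + y7) ^ 2 +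
        (-2 * y1 - 4 * y2 - 5 * y3 - 6 * y4 - 7 * y5 - 8 * y6 - 9 * y7) ^ 2) := by
  have hsq : 0 ≤ (
    305 * (20 * y7 - y1 - 2 * y2 - 3 * y3 - 4 * y4 - 5 * y5 + 8 * y6) ^ 2 +
    300 * (20 * y1 + 7 * y2 - 5 * y3 - 4 * y4 - 4 * y5 - 2 * y6) ^ 2 +
    186 * (20 * y6 - 4 * y2 - 9 * y3 - 10 * y4 + 9 * y5) ^ 2 +
    173 * (20 * y2 + 7 * y3 - 15 * y4 - 7 * y5) ^ 2 + 40800 * (y5 - y3) ^ 2 +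
    7 * (20 * y4 + 13 * y3) ^ 2 : ℝ) := by
    positivity
  have hmon : 0 ≤ (
    2895 * y1 ^ 2 + 7580 * y1 * y2 + 2170 * y1 * y3 + 760 * y1 * y4 + 11350 * y1 * y5 +
    6480 * y1 * y6 + 1000 * y1 * y7 + 4704 * y2 ^ 2 + 3508 * y2 * y3 + 11240 * y2 * y4 +
    5332 * y2 * y5 + 3120 * y2 * y6 + 2000 * y2 * y7 + 4229 * y3 ^ 2 + 11890 * y3 * y4 +
    11536 * y3 * y5 + 11600 * y3 * y6 + 4600 * y3 * y7 + 6795 * y4 ^ 2 + 10550 * y4 * y5 +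
    5920 * y4 * y6 + 7200 * y4 * y7 + 6432 * y5 ^ 2 + 10240 * y5 * y6 + 9800 * y5 * y7 +
    4080 * y6 ^ 2 + 1600 * y6 * y7 + 2800 * y7 ^ 2 : ℝ) := by
    positivity
  -- The squares are normalised to pivot coefficient 20, whence `400 = 20 ^ 2`; the later
  -- certificates use 16 and 50.
  linear_combination (1 / 400) * hsq + (1 / 400) * hmon

theorem gap_cubic_nonneg {y1 y2 y3 y4 y5 y6 y7 : ℝ} (h1 : 0 ≤ y1) (h2 : 0 ≤ y2) (h3 : 0 ≤ y3)
    (h4 : 0 ≤ y4) (h5 : 0 ≤ y5) (h6 : 0 ≤ y6) (h7 : 0 ≤ y7) :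
    0 ≤
      200 * (2 * y1 ^ 2 * (y1 + 2 * y2 + 2 * y3 + 2 * y4 + 2 * y5 + 2 * y6 + 2 * y7) +
        y1 * y2 * ((y1 + 2 * y2 + 2 * y3 + 2 * y4 + 2 * y5 + 2 * y6 + 2 * y7) + (y2 + 2 * y3 + 2 *
          y4 + 2 * y5 + 2 * y6 + 2 * y7)) +
        2 * y2 ^ 2 * (y2 + 2 * y3 + 2 * y4 + 2 * y5 + 2 * y6 + 2 * y7) +
        y2 * y3 * ((y2 + 2 * y3 + 2 * y4 + 2 * y5 + 2 * y6 + 2 * y7) + (y3 + 2 * y4 + 2 * y5 + 2 *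
          y6 + 2 * y7)) +
        2 * y3 ^ 2 * (y3 + 2 * y4 + 2 * y5 + 2 * y6 + 2 * y7) +
        y3 * y4 * ((y3 + 2 * y4 + 2 * y5 + 2 * y6 + 2 * y7) + (y4 + 2 * y5 + 2 * y6 + 2 * y7)) +
        2 * y4 ^ 2 * (y4 + 2 * y5 + 2 * y6 + 2 * y7) +
        y4 * y5 * ((y4 + 2 * y5 + 2 * y6 + 2 * y7) + (y5 + 2 * y6 + 2 * y7)) +
        2 * y5 ^ 2 * (y5 + 2 * y6 + 2 * y7) +
        y5 * y6 * ((y5 + 2 * y6 + 2 * y7) + (y6 + 2 * y7)) + 2 * y6 ^ 2 * (y6 + 2 * y7) +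
        y6 * y7 * ((y6 + 2 * y7) + y7) + 2 * y7 ^ 2 * y7) -
      2 * ((y1 + y2 + y3 + y4 + y5 + y6 + y7) * (8 * y1 + 6 * y2 + 5 * y3 + 4 * y4 + 3 * y5 + 2 *
        y6 + y7) ^ 2 +
        (y2 + y3 + y4 + y5 + y6 + y7) * (-2 * y1 + 6 * y2 + 5 * y3 + 4 * y4 + 3 * y5 + 2 * y6 +
          y7) ^ 2 +
        (y3 + y4 + y5 + y6 + y7) * (-2 * y1 - 4 * y2 + 5 * y3 + 4 * y4 + 3 * y5 + 2 * y6 + y7) ^ 2 +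
        (y4 + y5 + y6 + y7) * (-2 * y1 - 4 * y2 - 5 * y3 + 4 * y4 + 3 * y5 + 2 * y6 + y7) ^ 2 +
        (y5 + y6 + y7) * (-2 * y1 - 4 * y2 - 5 * y3 - 6 * y4 + 3 * y5 + 2 * y6 + y7) ^ 2 +
        (y6 + y7) * (-2 * y1 - 4 * y2 - 5 * y3 - 6 * y4 - 7 * y5 + 2 * y6 + y7) ^ 2 +
        y7 * (-2 * y1 - 4 * y2 - 5 * y3 - 6 * y4 - 7 * y5 - 8 * y6 + y7) ^ 2) := by
  have hsq : 0 ≤ (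
    241 * y3 * (16 * y1 - 5 * y3 - 9 * y4) ^ 2 + 7168 * y3 * (2 * y4 + y3) ^ 2 +
    256 * y3 * y3 ^ 2 + 128 * y4 * (16 * y4 - 5 * y1 - 9 * y2) ^ 2 +
    56 * y4 * (16 * y2 + 9 * y1) ^ 2 + 256 * y4 * y1 ^ 2 +
    354 * y5 * (16 * y1 + 4 * y2 - 8 * y3 - 4 * y4 - y5 - 3 * y6) ^ 2 +
    337 * y5 * (16 * y6 - 4 * y2 - 11 * y3 + 3 * y4 + 6 * y5) ^ 2 +
    219 * y5 * (16 * y4 - 9 * y2 + 2 * y3 - y5) ^ 2 + 2304 * y5 * (4 * y2 + y3) ^ 2 +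
    45 * y5 * (16 * y3 - y5) ^ 2 + 2048 * y5 * y5 ^ 2 +
    342 * y6 * (16 * y4 - 5 * y1 - 9 * y2 + 4 * y3 - 2 * y6) ^ 2 +
    234 * y6 * (16 * y1 + 2 * y2 - 8 * y3 - y6) ^ 2 +
    168 * y6 * (16 * y2 + 7 * y3 - 2 * y6) ^ 2 + 109 * y6 * (16 * y3 - y6) ^ 2 +
    21504 * y6 * y6 ^ 2 +
    433 * y7 * (16 * y1 + 5 * y2 - 7 * y3 - 4 * y4 - 3 * y5 - 2 * y6) ^ 2 +
    399 * y7 * (16 * y5 - 6 * y2 - 11 * y3 + 2 * y4 + 5 * y6 - y7) ^ 2 +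
    358 * y7 * (16 * y6 - y2 - 2 * y3 - 10 * y4 + y7) ^ 2 +
    313 * y7 * (16 * y2 - 11 * y4 - y7) ^ 2 + 42 * y7 * (16 * y3 + 6 * y4 - 11 * y7) ^ 2 +
    19 * y7 * (16 * y7 - 5 * y4) ^ 2 : ℝ) := by
    positivity
  have hmon : 0 ≤ (
    69632 * y1 ^ 3 + 172032 * y1 ^ 2 * y2 + 65280 * y1 ^ 2 * y3 + 125128 * y1 ^ 2 * y4 +
    48640 * y1 ^ 2 * y5 + 76954 * y1 ^ 2 * y6 + 40704 * y1 ^ 2 * y7 + 98304 * y1 * y2 ^ 2 +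
    98304 * y1 * y2 * y3 + 74752 * y1 * y2 * y4 + 61184 * y1 * y2 * y5 +
    64836 * y1 * y2 * y6 + 45408 * y1 * y2 * y7 + 5280 * y1 * y3 ^ 2 +
    1824 * y1 * y3 * y4 + 22016 * y1 * y3 * y5 + 3952 * y1 * y3 * y6 +
    26336 * y1 * y3 * y7 + 4096 * y1 * y4 ^ 2 + 6400 * y1 * y4 * y5 + 9664 * y1 * y4 * y6 +
    4224 * y1 * y4 * y7 + 6720 * y1 * y5 ^ 2 + 13504 * y1 * y5 * y6 + 9824 * y1 * y5 * y7 +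
    2696 * y1 * y6 ^ 2 + 15424 * y1 * y6 * y7 + 3584 * y1 * y7 ^ 2 + 65536 * y2 ^ 3 +
    149504 * y2 ^ 2 * y3 + 77696 * y2 ^ 2 * y4 + 40837 * y2 ^ 2 * y5 +
    38946 * y2 ^ 2 * y6 + 9013 * y2 ^ 2 * y7 + 87040 * y2 * y3 ^ 2 + 69632 * y2 * y3 * y4 +
    50036 * y2 * y3 * y5 + 60016 * y2 * y3 * y6 + 39698 * y2 * y3 * y7 +
    4096 * y2 * y4 ^ 2 + 4664 * y2 * y4 * y5 + 8384 * y2 * y4 * y6 + 27512 * y2 * y4 * y7 +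
    5850 * y2 * y5 ^ 2 + 10672 * y2 * y5 * y6 + 26110 * y2 * y5 * y7 + 3472 * y2 * y6 ^ 2 +
    19480 * y2 * y6 * y7 + 13112 * y2 * y7 ^ 2 + 50551 * y3 ^ 3 + 92998 * y3 ^ 2 * y4 +
    16587 * y3 ^ 2 * y5 + 40696 * y3 ^ 2 * y6 + 18160 * y3 ^ 2 * y7 + 39871 * y3 * y4 ^ 2 +
    51106 * y3 * y4 * y5 + 13568 * y3 * y4 * y6 + 20076 * y3 * y4 * y7 +
    11952 * y3 * y5 ^ 2 + 21760 * y3 * y5 * y6 + 20886 * y3 * y5 * y7 +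
    3776 * y3 * y6 ^ 2 + 7574 * y3 * y6 * y7 + 11022 * y3 * y7 ^ 2 + 36864 * y4 ^ 3 +
    90887 * y4 ^ 2 * y5 + 14848 * y4 ^ 2 * y6 + 16168 * y4 ^ 2 * y7 + 96492 * y4 * y5 ^ 2 +
    45168 * y4 * y5 * y6 + 29608 * y4 * y5 * y7 + 5504 * y4 * y6 ^ 2 +
    30020 * y4 * y6 * y7 + 10454 * y4 * y7 ^ 2 + 64562 * y5 ^ 3 + 110324 * y5 ^ 2 * y6 +
    10183 * y5 ^ 2 * y7 + 37518 * y5 * y6 ^ 2 + 43604 * y5 * y6 * y7 + 9184 * y5 * y7 ^ 2 +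
    66225 * y6 ^ 3 + 95301 * y6 ^ 2 * y7 + 138966 * y6 * y7 ^ 2 + 87800 * y7 ^ 3 : ℝ) := by
    positivity
  linear_combination (1 / 256) * hsq + (1 / 256) * hmon

-- The case `t = 0`; the fourth powers on the left are the slack that later forces all gaps to
-- vanish in the equality case.
set_option maxHeartbeats 1000000 in
theorem sum_gap_pow_four_le {y1 y2 y3 y4 y5 y6 y7 : ℝ} (h1 : 0 ≤ y1) (h2 : 0 ≤ y2) (h3 : 0 ≤ y3)
    (h4 : 0 ≤ y4) (h5 : 0 ≤ y5) (h6 : 0 ≤ y6) (h7 : 0 ≤ y7) :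
    y1 ^ 4 + y2 ^ 4 + y3 ^ 4 + y4 ^ 4 + y5 ^ 4 + y6 ^ 4 + y7 ^ 4 ≤
      100 * ((y1 * (y1 + 2 * y2 + 2 * y3 + 2 * y4 + 2 * y5 + 2 * y6 + 2 * y7)) ^ 2 +
        y1 * (y1 + 2 * y2 + 2 * y3 + 2 * y4 + 2 * y5 + 2 * y6 + 2 * y7) * (y2 * (y2 + 2 * y3 + 2 *
          y4 + 2 * y5 + 2 * y6 + 2 * y7)) +
        (y2 * (y2 + 2 * y3 + 2 * y4 + 2 * y5 + 2 * y6 + 2 * y7)) ^ 2 +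
        y2 * (y2 + 2 * y3 + 2 * y4 + 2 * y5 + 2 * y6 + 2 * y7) * (y3 * (y3 + 2 * y4 + 2 * y5 + 2 *
          y6 + 2 * y7)) +
        (y3 * (y3 + 2 * y4 + 2 * y5 + 2 * y6 + 2 * y7)) ^ 2 +
        y3 * (y3 + 2 * y4 + 2 * y5 + 2 * y6 + 2 * y7) * (y4 * (y4 + 2 * y5 + 2 * y6 + 2 * y7)) +
        (y4 * (y4 + 2 * y5 + 2 * y6 + 2 * y7)) ^ 2 +
        y4 * (y4 + 2 * y5 + 2 * y6 + 2 * y7) * (y5 * (y5 + 2 * y6 + 2 * y7)) +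
        (y5 * (y5 + 2 * y6 + 2 * y7)) ^ 2 +
        y5 * (y5 + 2 * y6 + 2 * y7) * (y6 * (y6 + 2 * y7)) + (y6 * (y6 + 2 * y7)) ^ 2 +
        y6 * (y6 + 2 * y7) * (y7 * y7) + (y7 * y7) ^ 2) -
      (((y1 + y2 + y3 + y4 + y5 + y6 + y7) * (8 * y1 + 6 * y2 + 5 * y3 + 4 * y4 + 3 * y5 + 2 *
        y6 + y7)) ^ 2 +
        ((y2 + y3 + y4 + y5 + y6 + y7) * (-2 * y1 + 6 * y2 + 5 * y3 + 4 * y4 + 3 * y5 + 2 * y6 +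
          y7)) ^ 2 +
        ((y3 + y4 + y5 + y6 + y7) * (-2 * y1 - 4 * y2 + 5 * y3 + 4 * y4 + 3 * y5 + 2 * y6 + y7)) ^
          2 +
        ((y4 + y5 + y6 + y7) * (-2 * y1 - 4 * y2 - 5 * y3 + 4 * y4 + 3 * y5 + 2 * y6 + y7)) ^ 2 +
        ((y5 + y6 + y7) * (-2 * y1 - 4 * y2 - 5 * y3 - 6 * y4 + 3 * y5 + 2 * y6 + y7)) ^ 2 +
        ((y6 + y7) * (-2 * y1 - 4 * y2 - 5 * y3 - 6 * y4 - 7 * y5 + 2 * y6 + y7)) ^ 2 +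
        (y7 * (-2 * y1 - 4 * y2 - 5 * y3 - 6 * y4 - 7 * y5 - 8 * y6 + y7)) ^ 2) := by
  have hsq : 0 ≤ (
    210 * (50 * y1 * y5 + 37 * y1 * y3 + 37 * y1 * y4 + 34 * y1 * y6 + 30 * y1 * y7 + 3 * y2 ^ 2 +
      10 * y2 * y4 + 13 * y2 * y5 + 10 * y2 * y6 + 9 * y2 * y7 - 13 * y3 ^ 2 - 22 * y3 * y4 - 21 *
      y3 * y5 - 19 * y3 * y6 - 18 * y3 * y7 - 6 * y4 ^ 2 - 13 * y4 * y5 - 11 * y4 * y6 - 12 * y4 *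
      y7 - 3 * y5 ^ 2 - 8 * y5 * y6 - 7 * y5 * y7 - 3 * y6 ^ 2 - 6 * y6 * y7 - 3 * y7 ^ 2) ^ 2 +
    204 * (50 * y6 * y7 - 3 * y1 * y3 - 3 * y1 * y4 + 2 * y1 * y6 + y1 * y7 - y2 ^ 2 - 8 * y2 *
      y4 - 6 * y2 * y5 - y2 * y6 - 3 * y2 * y7 - 3 * y3 ^ 2 - 11 * y3 * y5 - 9 * y3 * y6 - 16 * y3 *
      y7 + 4 * y4 ^ 2 + 4 * y4 * y5 - 9 * y4 * y6 - 18 * y4 * y7 + 11 * y5 ^ 2 + 16 * y5 * y6 +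
      10 * y5 * y7 + 21 * y6 ^ 2 + 19 * y7 ^ 2) ^ 2 +
    169 * (50 * y5 * y6 - y1 * y3 + y1 * y4 - 6 * y2 ^ 2 - 11 * y2 * y4 - 2 * y2 * y5 - 14 * y2 *
      y6 - 13 * y2 * y7 - 5 * y3 ^ 2 - 13 * y3 * y4 - 18 * y3 * y5 - 28 * y3 * y6 - 28 * y3 * y7 +
      9 * y4 ^ 2 + 14 * y4 * y5 + 6 * y4 * y6 + 8 * y4 * y7 + 17 * y5 ^ 2 + 29 * y5 * y7 + 10 *
      y6 ^ 2 + 4 * y7 ^ 2) ^ 2 +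
    136 * (50 * y2 * y6 + 9 * y1 * y3 + 9 * y1 * y6 + 4 * y1 * y7 + 9 * y2 ^ 2 + 23 * y2 * y4 +
      32 * y2 * y5 + 34 * y2 * y7 - y3 ^ 2 - 4 * y3 * y4 + 4 * y3 * y5 + 2 * y3 * y6 - y3 * y7 -
      11 * y4 ^ 2 - 27 * y4 * y5 - 33 * y4 * y6 - 29 * y4 * y7 - 5 * y5 ^ 2 - 2 * y5 * y7 + 4 * y6 ^
      2 - y7 ^ 2) ^ 2 +
    77 * (50 * y2 * y5 + 6 * y1 * y3 + 5 * y1 * y4 + 4 * y1 * y6 + 3 * y1 * y7 + 5 * y2 ^ 2 + 19 *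
      y2 * y4 + 3 * y2 * y7 - y3 ^ 2 - 13 * y3 * y4 - y3 * y5 + 3 * y3 * y6 - 6 * y4 ^ 2 - 24 *
      y4 * y5 - 7 * y4 * y6 - 6 * y4 * y7 - y5 ^ 2 + 2 * y5 * y7 - 4 * y7 ^ 2) ^ 2 +
    64 * (50 * y3 * y7 - 5 * y1 * y4 - 17 * y1 * y6 - 21 * y1 * y7 + 6 * y2 ^ 2 + 12 * y2 * y4 +
      16 * y2 * y7 + 4 * y3 ^ 2 + 7 * y3 * y4 + 11 * y3 * y5 + 25 * y3 * y6 - 7 * y4 ^ 2 - 10 * y4 *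
      y5 - 9 * y4 * y6 - 10 * y4 * y7 - 11 * y5 ^ 2 - 35 * y5 * y7 + 4 * y6 ^ 2 + 14 * y7 ^ 2) ^
      2 +
    57 * (50 * y1 * y4 + 18 * y1 * y3 + 10 * y1 * y6 + 3 * y1 * y7 + 6 * y2 ^ 2 - y2 * y4 - 7 *
      y2 * y7 - 7 * y3 ^ 2 - 15 * y3 * y4 + 3 * y3 * y5 - 6 * y3 * y6 - 7 * y4 ^ 2 + 3 * y4 * y5 -
      2 * y4 * y6 + y4 * y7 - 4 * y5 ^ 2 - 2 * y5 * y7 + 3 * y6 ^ 2 + 4 * y7 ^ 2) ^ 2 +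
    52 * (50 * y1 * y6 - 4 * y1 * y3 + 15 * y1 * y7 - y2 ^ 2 + 5 * y2 * y4 - 6 * y2 * y7 - y3 ^
      2 - 12 * y3 * y4 - 8 * y3 * y5 - 17 * y3 * y6 - 2 * y4 * y5 - 5 * y4 * y6 + 2 * y4 * y7 + 6 *
      y5 ^ 2 - 12 * y5 * y7 + 2 * y6 ^ 2 + 5 * y7 ^ 2) ^ 2 +
    50 * (50 * y7 ^ 2 + 5 * y1 * y3 + 11 * y1 * y7 - 3 * y2 * y4 + 6 * y2 * y7 - 2 * y3 ^ 2 - 3 *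
      y3 * y5 + y3 * y6 + y4 ^ 2 - y4 * y5 - 10 * y4 * y6 - 5 * y4 * y7 + 4 * y5 ^ 2 - 19 * y5 *
      y7 + 12 * y6 ^ 2) ^ 2 +
    47 * (50 * y2 * y4 + 7 * y1 * y3 + 7 * y1 * y7 + 20 * y2 ^ 2 - y2 * y7 - 2 * y3 ^ 2 - 21 *
      y3 * y4 + 2 * y3 * y5 + 4 * y3 * y6 - 19 * y4 ^ 2 - 14 * y4 * y5 - 7 * y4 * y6 - 6 * y4 * y7 +
      y5 ^ 2 - 2 * y5 * y7 - y6 ^ 2) ^ 2 +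
    42 * (50 * y4 * y7 + y1 * y3 - 16 * y1 * y7 + 3 * y2 ^ 2 - 31 * y2 * y7 + y3 ^ 2 + 11 * y3 *
      y4 + 5 * y3 * y5 - 3 * y3 * y6 - 3 * y4 ^ 2 + 12 * y4 * y5 + 13 * y4 * y6 - 8 * y5 ^ 2 + y5 *
      y7 - 14 * y6 ^ 2) ^ 2 +
    32 * (50 * y1 * y7 - 5 * y1 * y3 - 2 * y2 ^ 2 + 12 * y2 * y7 + 3 * y3 ^ 2 + 2 * y3 * y5 + y3 *
      y6 - y4 ^ 2 - 10 * y4 * y5 - 5 * y4 * y6 + 2 * y5 ^ 2 - 29 * y5 * y7 + 5 * y6 ^ 2) ^ 2 +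
    21 * (50 * y3 * y4 + 23 * y2 ^ 2 + 7 * y2 * y7 + 13 * y3 ^ 2 + 36 * y3 * y5 + 4 * y3 * y6 -
      18 * y4 ^ 2 + 5 * y4 * y5 + 11 * y4 * y6 - 39 * y5 ^ 2 + 21 * y5 * y7 + 3 * y6 ^ 2) ^ 2 +
    20 * (50 * y2 * y7 + 13 * y1 * y3 - 2 * y2 ^ 2 - 7 * y3 ^ 2 - y3 * y5 - 11 * y3 * y6 + y4 ^
      2 + 22 * y4 * y5 + 7 * y4 * y6 - 3 * y5 ^ 2 + 9 * y5 * y7 - 10 * y6 ^ 2) ^ 2 +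
    19 * (50 * y6 ^ 2 + 9 * y1 * y3 - 4 * y3 ^ 2 - 6 * y3 * y5 + y3 * y6 - 6 * y4 * y5 - 10 * y4 *
      y6 + y5 ^ 2 - 9 * y5 * y7) ^ 2 +
    12 * (50 * y4 * y5 - 4 * y1 * y3 + 3 * y2 ^ 2 + 3 * y3 ^ 2 - 8 * y3 * y5 - 4 * y3 * y6 - 3 *
      y4 ^ 2 + 6 * y5 ^ 2 + 9 * y5 * y7) ^ 2 +
    10 * (50 * y3 * y6 - 15 * y1 * y3 + 3 * y2 ^ 2 + 9 * y3 ^ 2 - 4 * y3 * y5 - y4 ^ 2 + y4 * y6 -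
      7 * y5 ^ 2 + 12 * y5 * y7) ^ 2 +
    5 * (50 * y1 * y3 + y2 ^ 2 - 18 * y3 ^ 2 - 19 * y3 * y5 - 6 * y4 ^ 2 + 18 * y4 * y6 + 13 *
      y5 ^ 2 + 8 * y5 * y7) ^ 2 +
    2 * (50 * y5 * y7 - 19 * y2 ^ 2 - 8 * y3 ^ 2 - 36 * y3 * y5 - 18 * y4 ^ 2 + 28 * y4 * y6 +
      32 * y5 ^ 2) ^ 2 : ℝ) := by
    positivity
  have hmon : 0 ≤ (
    87500 * y1 ^ 4 + 440000 * y1 ^ 3 * y2 + 480000 * y1 ^ 3 * y3 + 520000 * y1 ^ 3 * y4 +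
    560000 * y1 ^ 3 * y5 + 600000 * y1 ^ 3 * y6 + 640000 * y1 ^ 3 * y7 +
    510000 * y1 ^ 2 * y2 ^ 2 + 1130000 * y1 ^ 2 * y2 * y3 + 1240000 * y1 ^ 2 * y2 * y4 +
    1350000 * y1 ^ 2 * y2 * y5 + 1460000 * y1 ^ 2 * y2 * y6 + 1570000 * y1 ^ 2 * y2 * y7 +
    10661 * y1 ^ 2 * y3 ^ 2 + 134466 * y1 ^ 2 * y3 * y4 + 148000 * y1 ^ 2 * y3 * y5 +
    478640 * y1 ^ 2 * y3 * y6 + 664782 * y1 ^ 2 * y3 * y7 + 14480 * y1 ^ 2 * y4 ^ 2 +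
    223000 * y1 ^ 2 * y4 * y5 + 503128 * y1 ^ 2 * y4 * y6 + 702174 * y1 ^ 2 * y4 * y7 +
    12500 * y1 ^ 2 * y5 ^ 2 + 456000 * y1 ^ 2 * y5 * y6 + 635000 * y1 ^ 2 * y5 * y7 +
    209980 * y1 ^ 2 * y6 ^ 2 + 762028 * y1 ^ 2 * y6 * y7 + 365885 * y1 ^ 2 * y7 ^ 2 +
    140000 * y1 * y2 ^ 3 + 408424 * y1 * y2 ^ 2 * y3 + 519974 * y1 * y2 ^ 2 * y4 +
    627000 * y1 * y2 ^ 2 * y5 + 724280 * y1 * y2 ^ 2 * y6 + 833414 * y1 * y2 ^ 2 * y7 +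
    55000 * y1 * y2 * y3 ^ 2 + 9962 * y1 * y2 * y3 * y4 + 115424 * y1 * y2 * y3 * y5 +
    336244 * y1 * y2 * y3 * y6 + 546040 * y1 * y2 * y3 * y7 + 17276 * y1 * y2 * y4 ^ 2 +
    62812 * y1 * y2 * y4 * y5 + 325080 * y1 * y2 * y4 * y6 + 587352 * y1 * y2 * y4 * y7 +
    22000 * y1 * y2 * y5 ^ 2 + 240120 * y1 * y2 * y5 * y6 + 481732 * y1 * y2 * y5 * y7 +
    135616 * y1 * y2 * y6 ^ 2 + 622852 * y1 * y2 * y6 * y7 + 313202 * y1 * y2 * y7 ^ 2 +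
    9166 * y1 * y3 ^ 3 + 36240 * y1 * y3 ^ 2 * y4 + 36948 * y1 * y3 ^ 2 * y5 +
    37822 * y1 * y3 ^ 2 * y6 + 34660 * y1 * y3 ^ 2 * y7 + 18104 * y1 * y3 * y4 ^ 2 +
    15518 * y1 * y3 * y4 * y5 + 97512 * y1 * y3 * y4 * y6 + 115142 * y1 * y3 * y4 * y7 +
    7546 * y1 * y3 * y5 ^ 2 + 11600 * y1 * y3 * y5 * y6 + 29820 * y1 * y3 * y5 * y7 +
    17682 * y1 * y3 * y6 ^ 2 + 70102 * y1 * y3 * y6 * y7 + 20060 * y1 * y3 * y7 ^ 2 +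
    15134 * y1 * y4 ^ 3 + 13164 * y1 * y4 ^ 2 * y5 + 14714 * y1 * y4 ^ 2 * y6 +
    27120 * y1 * y4 ^ 2 * y7 + 18868 * y1 * y4 * y5 ^ 2 + 46480 * y1 * y4 * y5 * y6 +
    116964 * y1 * y4 * y5 * y7 + 12620 * y1 * y4 * y6 ^ 2 + 76656 * y1 * y4 * y6 * y7 +
    11938 * y1 * y4 * y7 ^ 2 + 18000 * y1 * y5 ^ 3 + 59144 * y1 * y5 ^ 2 * y6 +
    51444 * y1 * y5 ^ 2 * y7 + 14184 * y1 * y5 * y6 ^ 2 + 54256 * y1 * y5 * y6 * y7 +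
    15056 * y1 * y5 * y7 ^ 2 + 10796 * y1 * y6 ^ 3 + 39008 * y1 * y6 ^ 2 * y7 +
    22352 * y1 * y6 * y7 ^ 2 + 21448 * y1 * y7 ^ 3 + 10553 * y2 ^ 4 +
    340000 * y2 ^ 3 * y3 + 188882 * y2 ^ 3 * y4 + 320280 * y2 ^ 3 * y5 +
    356200 * y2 ^ 3 * y6 + 455872 * y2 ^ 3 * y7 + 304436 * y2 ^ 2 * y3 ^ 2 +
    793202 * y2 ^ 2 * y3 * y4 + 873764 * y2 ^ 2 * y3 * y5 + 1045322 * y2 ^ 2 * y3 * y6 +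
    1213416 * y2 ^ 2 * y3 * y7 + 19171 * y2 ^ 2 * y4 ^ 2 + 243634 * y2 ^ 2 * y4 * y5 +
    387240 * y2 ^ 2 * y4 * y6 + 612334 * y2 ^ 2 * y4 * y7 + 27404 * y2 ^ 2 * y5 ^ 2 +
    356296 * y2 ^ 2 * y5 * y6 + 590342 * y2 ^ 2 * y5 * y7 + 25942 * y2 ^ 2 * y6 ^ 2 +
    405020 * y2 ^ 2 * y6 * y7 + 182993 * y2 ^ 2 * y7 ^ 2 + 50000 * y2 * y3 ^ 3 +
    327778 * y2 * y3 ^ 2 * y4 + 506660 * y2 * y3 ^ 2 * y5 + 613316 * y2 * y3 ^ 2 * y6 +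
    740296 * y2 * y3 ^ 2 * y7 + 19606 * y2 * y3 * y4 ^ 2 + 86828 * y2 * y3 * y4 * y5 +
    121570 * y2 * y3 * y4 * y6 + 315940 * y2 * y3 * y4 * y7 + 18448 * y2 * y3 * y5 ^ 2 +
    146408 * y2 * y3 * y5 * y6 + 398944 * y2 * y3 * y5 * y7 + 16432 * y2 * y3 * y6 ^ 2 +
    233490 * y2 * y3 * y6 * y7 + 42272 * y2 * y3 * y7 ^ 2 + 17644 * y2 * y4 ^ 3 +
    11666 * y2 * y4 ^ 2 * y5 + 11178 * y2 * y4 ^ 2 * y6 + 15740 * y2 * y4 ^ 2 * y7 +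
    15780 * y2 * y4 * y5 ^ 2 + 24620 * y2 * y4 * y5 * y6 + 16178 * y2 * y4 * y5 * y7 +
    14478 * y2 * y4 * y6 ^ 2 + 28574 * y2 * y4 * y6 * y7 + 13406 * y2 * y4 * y7 ^ 2 +
    16020 * y2 * y5 ^ 3 + 72180 * y2 * y5 ^ 2 * y6 + 96388 * y2 * y5 ^ 2 * y7 +
    16460 * y2 * y5 * y6 ^ 2 + 122592 * y2 * y5 * y6 * y7 + 13308 * y2 * y5 * y7 ^ 2 +
    14088 * y2 * y6 ^ 3 + 76570 * y2 * y6 ^ 2 * y7 + 6760 * y2 * y6 * y7 ^ 2 +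
    40908 * y2 * y7 ^ 3 + 6150 * y3 ^ 4 + 130846 * y3 ^ 3 * y4 + 213168 * y3 ^ 3 * y5 +
    281762 * y3 ^ 3 * y6 + 358944 * y3 ^ 3 * y7 + 20200 * y3 ^ 2 * y4 ^ 2 +
    359076 * y3 ^ 2 * y4 * y5 + 564426 * y3 ^ 2 * y4 * y6 + 771714 * y3 ^ 2 * y4 * y7 +
    2489 * y3 ^ 2 * y5 ^ 2 + 165726 * y3 ^ 2 * y5 * y6 + 288864 * y3 ^ 2 * y5 * y7 +
    16130 * y3 ^ 2 * y6 ^ 2 + 171600 * y3 ^ 2 * y6 * y7 + 11396 * y3 ^ 2 * y7 ^ 2 +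
    17494 * y3 * y4 ^ 3 + 247552 * y3 * y4 ^ 2 * y5 + 433160 * y3 * y4 ^ 2 * y6 +
    633566 * y3 * y4 ^ 2 * y7 + 21968 * y3 * y4 * y5 ^ 2 + 213922 * y3 * y4 * y5 * y6 +
    362256 * y3 * y4 * y5 * y7 + 12850 * y3 * y4 * y6 ^ 2 + 172036 * y3 * y4 * y6 * y7 +
    19896 * y3 * y4 * y7 ^ 2 + 14332 * y3 * y5 ^ 3 + 23892 * y3 * y5 ^ 2 * y6 +
    57028 * y3 * y5 ^ 2 * y7 + 12886 * y3 * y5 * y6 ^ 2 + 47942 * y3 * y5 * y6 * y7 +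
    11972 * y3 * y5 * y7 ^ 2 + 66948 * y3 * y6 ^ 3 + 200256 * y3 * y6 ^ 2 * y7 +
    53892 * y3 * y6 * y7 ^ 2 + 59336 * y3 * y7 ^ 3 + 12633 * y4 ^ 4 +
    232578 * y4 ^ 3 * y5 + 376458 * y4 ^ 3 * y6 + 476710 * y4 ^ 3 * y7 +
    15458 * y4 ^ 2 * y5 ^ 2 + 490498 * y4 ^ 2 * y5 * y6 + 777264 * y4 ^ 2 * y5 * y7 +
    11741 * y4 ^ 2 * y6 ^ 2 + 224948 * y4 ^ 2 * y6 * y7 + 14405 * y4 ^ 2 * y7 ^ 2 +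
    18262 * y4 * y5 ^ 3 + 336730 * y4 * y5 ^ 2 * y6 + 555666 * y4 * y5 ^ 2 * y7 +
    13072 * y4 * y5 * y6 ^ 2 + 196770 * y4 * y5 * y6 * y7 + 13060 * y4 * y5 * y7 ^ 2 +
    13852 * y4 * y6 ^ 3 + 108094 * y4 * y6 ^ 2 * y7 + 21108 * y4 * y6 * y7 ^ 2 +
    133440 * y4 * y7 ^ 3 + 5962 * y5 ^ 4 + 255812 * y5 ^ 3 * y6 + 475486 * y5 ^ 3 * y7 +
    19600 * y5 ^ 2 * y6 ^ 2 + 719140 * y5 ^ 2 * y6 * y7 + 39273 * y5 ^ 2 * y7 ^ 2 +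
    3832 * y5 * y6 ^ 3 + 635318 * y5 * y6 ^ 2 * y7 + 11648 * y5 * y6 * y7 ^ 2 +
    10012 * y5 * y7 ^ 3 + 8857 * y6 ^ 4 + 384040 * y6 ^ 3 * y7 + 128860 * y6 ^ 2 * y7 ^ 2 +
    54840 * y6 * y7 ^ 3 + 10638 * y7 ^ 4 : ℝ) := by
    positivity
  linear_combination (1 / 2500) * hsq + (1 / 2500) * hmon

/-! ### Cuts of the 8-cycle and the energy of a rearrangement -/

set_option maxRecDepth 100000 in
theorem two_le_sum_cyclic_xor : ∀ S : Fin 8 → Bool, (∃ i, S i = true) → (∃ i, S i = false) →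
    2 ≤ ∑ i, (xor (S i) (S (i + 1))).toNat := by
  decide

-- Deleting a vertex from the cycle leaves a path, and a nonconstant labelling of a path changes
-- along some edge.
set_option maxRecDepth 100000 in
theorem exists_adjacent_ne_avoiding_zero : ∀ S : Fin 8 → Bool, (∃ i, i ≠ 0 ∧ S i = true) →
    (∃ i, i ≠ 0 ∧ S i = false) → ∃ m, m ≠ 0 ∧ m + 1 ≠ 0 ∧ S m ≠ S (m + 1) := by
  decide

theorem exists_adjacent_ne_avoiding {S : Fin 8 → Bool} {v i j : Fin 8} (hi : i ≠ v) (hj : j ≠ v)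
    (hSi : S i = true) (hSj : S j = false) :
    ∃ m, m ≠ v ∧ m + 1 ≠ v ∧ S m ≠ S (m + 1) := by
  obtain ⟨m, h1, h2, h3⟩ := exists_adjacent_ne_avoiding_zero (fun m => S (m + v))
    ⟨i - v, sub_ne_zero.2 hi, by simpa using hSi⟩ ⟨j - v, sub_ne_zero.2 hj, by simpa using hSj⟩
  refine ⟨m + v, by simpa using h1, ?_, ?_⟩
  · rw [add_right_comm]; simpa using h2
  · rw [add_right_comm]; exact h3

/-- The signed crossing, by the step from `i` to `i + 1`, of the threshold between the ranks `k`
and `k + 1`. -/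
def cutSign (τ : Equiv.Perm (Fin 8)) (k : Fin 7) (i : Fin 8) : ℝ :=
  (if τ i ≤ k.castSucc then 1 else 0) - (if τ (i + 1) ≤ k.castSucc then 1 else 0)

/-- The sets of ranks below the thresholds are nested, so a step crosses all its thresholds in the
same direction. -/
theorem cutSign_mul_nonneg (τ : Equiv.Perm (Fin 8)) (k l : Fin 7) (i : Fin 8) :
    0 ≤ cutSign τ k i * cutSign τ l i := by
  unfold cutSign
  rcases le_total k l with h | h
  all_goals
    have h' := Fin.castSucc_le_castSucc_iff.2 h
    split_ifs with h1 h2 h3 h4 h5 h6 <;> norm_num <;> order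

theorem two_le_sum_cutSign_sq (τ : Equiv.Perm (Fin 8)) (k : Fin 7) :
    2 ≤ ∑ i, cutSign τ k i * cutSign τ k i := by
  have h := two_le_sum_cyclic_xor (fun i => decide (τ i ≤ k.castSucc))
    ⟨τ.symm 0, by simp⟩ ⟨τ.symm 7, by
      simp only [Equiv.apply_symm_apply, decide_eq_false_iff_not, not_le]
      exact Fin.castSucc_lt_last k⟩
  have h' : ((2 : ℕ) : ℝ) ≤ _ := Nat.cast_le.2 h
  rw [Nat.cast_sum] at h'
  refine le_trans (by norm_num) (h'.trans (Finset.sum_le_sum fun i _ => ?_))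
  unfold cutSign
  by_cases h1 : τ i ≤ k.castSucc <;> by_cases h2 : τ (i + 1) ≤ k.castSucc <;> simp [h1, h2]

/-- Delete the vertex whose rank lies between the two thresholds. On the remaining path both
thresholds induce the same labelling, so an edge where it changes crosses both. -/
theorem one_le_sum_cutSign_mul_succ (τ : Equiv.Perm (Fin 8)) (k : Fin 6) :
    1 ≤ ∑ i, cutSign τ k.castSucc i * cutSign τ k.succ i := by
  obtain ⟨m, h1, h2, h3⟩ := exists_adjacent_ne_avoiding
    (S := fun i => decide (τ i ≤ k.castSucc.castSucc)) (v := τ.symm k.succ.castSucc)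
    (i := τ.symm 0) (j := τ.symm 7)
    (by
      intro h
      have := congrArg Fin.val (τ.symm.injective h)
      simp at this)
    (by
      intro h
      have := congrArg Fin.val (τ.symm.injective h)
      simp at this
      omega)
    (by simp)
    (by
      simp only [Equiv.apply_symm_apply, decide_eq_false_iff_not, not_le]
      exact Fin.castSucc_lt_last _)
  refine le_trans ?_ (Finset.single_le_sum (f := fun i => cutSign τ k.castSucc i * cutSign τ k.succ i)
    (fun i _ => cutSign_mul_nonneg τ _ _ i) (Finset.mem_univ m))
  have iff : ∀ i, i ≠ τ.symm k.succ.castSucc →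
      (τ i ≤ k.succ.castSucc ↔ τ i ≤ k.castSucc.castSucc) := by
    intro i hi
    have : τ i ≠ k.succ.castSucc := fun h => hi (by rw [← h, Equiv.symm_apply_apply])
    rw [Ne, Fin.ext_iff] at this
    rw [Fin.le_def, Fin.le_def]
    simp only [Fin.val_castSucc, Fin.val_succ] at this ⊢
    omega
  simp only [cutSign, iff m h1, iff (m + 1) h2]
  simp only [ne_eq, decide_eq_decide] at h3
  by_cases h4 : τ m ≤ k.castSucc.castSucc <;> by_cases h5 : τ (m + 1) ≤ k.castSucc.castSucc <;>
    first
    | exact absurd (iff_of_true h4 h5) h3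
    | exact absurd (iff_of_false h4 h5) h3
    | norm_num [h4, h5]

theorem eq_last_add_sum_gaps (p : Fin 8 → ℝ) (u : Fin 8) :
    p u = p 7 + ∑ k : Fin 7, (if u ≤ k.castSucc then 1 else 0) * (p k.castSucc - p k.succ) := by
  fin_cases u <;> simp [Fin.sum_univ_succ, Fin.le_def] <;> ring!

/-- Each step is a signed sum of the gaps it crosses, so the energy is a quadratic form in the
nonnegative gaps. Its coefficients are bounded below by 2 on the diagonal, 1 next to it and 0
elsewhere. -/
theorem cyclic_dirichlet_energy_ge {p : Fin 8 → ℝ} (hp : Antitone p) (τ : Equiv.Perm (Fin 8)) :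
    2 * ∑ k : Fin 7, (p k.castSucc - p k.succ) ^ 2 +
      2 * ∑ k : Fin 6, (p k.castSucc.castSucc - p k.castSucc.succ) *
        (p k.succ.castSucc - p k.succ.succ) ≤
      ∑ i, (p (τ i) - p (τ (i + 1))) ^ 2 := by
  set D : Fin 7 → ℝ := fun k => p k.castSucc - p k.succ with hD
  have hD0 : ∀ k, 0 ≤ D k := fun k => sub_nonneg.2 (hp (Fin.castSucc_lt_succ (i := k)).le)
  have hdiff : ∀ i, p (τ i) - p (τ (i + 1)) = ∑ k, cutSign τ k i * D k := by
    intro i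
    rw [eq_last_add_sum_gaps p (τ i), eq_last_add_sum_gaps p (τ (i + 1)), add_sub_add_left_eq_sub,
      ← Finset.sum_sub_distrib]
    exact Finset.sum_congr rfl fun k _ => by rw [cutSign, sub_mul]
  have hexp : ∑ i, (p (τ i) - p (τ (i + 1))) ^ 2 =
      ∑ k, ∑ l, (∑ i, cutSign τ k i * cutSign τ l i) * (D k * D l) := by
    simp_rw [hdiff, sq, Finset.sum_mul_sum, Finset.sum_mul]
    rw [Finset.sum_comm]
    refine Finset.sum_congr rfl fun k _ => ?_
    rw [Finset.sum_comm]
    exact Finset.sum_congr rfl fun l _ => Finset.sum_congr rfl fun i _ => by ring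
  let M : Fin 7 → Fin 7 → ℝ := fun k l =>
    if k = l then 2 else if k.val + 1 = l.val ∨ l.val + 1 = k.val then 1 else 0
  have hM : ∀ k l, M k l ≤ ∑ i, cutSign τ k i * cutSign τ l i := by
    intro k l
    have succ_case : ∀ k l : Fin 7, k.val + 1 = l.val → 1 ≤ ∑ i, cutSign τ k i * cutSign τ l i := by
      intro k l h
      have hk : k.val < 6 := by omega
      have e1 : k = (⟨k.val, hk⟩ : Fin 6).castSucc := rfl
      have e2 : l = (⟨k.val, hk⟩ : Fin 6).succ := Fin.ext h.symm
      rw [e1, e2]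
      exact one_le_sum_cutSign_mul_succ τ _
    simp only [M]
    split_ifs with h1 h2
    · subst h1; exact two_le_sum_cutSign_sq τ k
    · rcases h2 with h2 | h2
      · exact succ_case k l h2
      · simpa only [mul_comm] using succ_case l k h2
    · exact Finset.sum_nonneg fun i _ => cutSign_mul_nonneg τ k l i
  have hsum : ∑ k, ∑ l, M k l * (D k * D l) ≤ ∑ i, (p (τ i) - p (τ (i + 1))) ^ 2 := by
    rw [hexp]
    exact Finset.sum_le_sum fun k _ => Finset.sum_le_sum fun l _ =>
      mul_le_mul_of_nonneg_right (hM k l) (mul_nonneg (hD0 k) (hD0 l))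
  refine le_trans (le_of_eq ?_) hsum
  change 2 * ∑ k, D k ^ 2 + 2 * ∑ k : Fin 6, D k.castSucc * D k.succ = _
  clear_value D
  simp [M, Fin.sum_univ_seven, Fin.sum_univ_six]
  ring!

/-! ### The variance bound for sorted, then cyclic, sequences -/

/-- The optimal `s` would be the quotient `B / A`; a fixed average favouring the two largest values
keeps the problem polynomial. Its weights sum to 1, so every `b j - s` depends on the gaps alone and
both sides have degree at most 2 in `t`. -/
theorem weighted_variance_add_gaps_le {t y1 y2 y3 y4 y5 y6 y7 b0 b1 b2 b3 b4 b5 b6 s : ℝ}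
    (ht : 0 ≤ t) (h1 : 0 ≤ y1) (h2 : 0 ≤ y2) (h3 : 0 ≤ y3) (h4 : 0 ≤ y4) (h5 : 0 ≤ y5)
    (h6 : 0 ≤ y6) (h7 : 0 ≤ y7) (e6 : b6 = t + y7) (e5 : b5 = b6 + y6) (e4 : b4 = b5 + y5)
    (e3 : b3 = b4 + y4) (e2 : b2 = b3 + y3) (e1 : b1 = b2 + y2) (e0 : b0 = b1 + y1)
    (hs : s = (2 * b0 + 2 * b1 + b2 + b3 + b4 + b5 + b6 + t) / 10) :
    b0 ^ 2 * (b0 - s) ^ 2 + b1 ^ 2 * (b1 - s) ^ 2 + b2 ^ 2 * (b2 - s) ^ 2 + b3 ^ 2 * (b3 - s) ^ 2 +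
        b4 ^ 2 * (b4 - s) ^ 2 + b5 ^ 2 * (b5 - s) ^ 2 + b6 ^ 2 * (b6 - s) ^ 2 +
        t ^ 2 * (t - s) ^ 2 +
        (y1 ^ 4 + y2 ^ 4 + y3 ^ 4 + y4 ^ 4 + y5 ^ 4 + y6 ^ 4 + y7 ^ 4) / 100 ≤
      (b0 ^ 2 - b1 ^ 2) ^ 2 + (b1 ^ 2 - b2 ^ 2) ^ 2 + (b2 ^ 2 - b3 ^ 2) ^ 2 +
        (b3 ^ 2 - b4 ^ 2) ^ 2 + (b4 ^ 2 - b5 ^ 2) ^ 2 + (b5 ^ 2 - b6 ^ 2) ^ 2 +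
        (b6 ^ 2 - t ^ 2) ^ 2 +
        ((b0 ^ 2 - b1 ^ 2) * (b1 ^ 2 - b2 ^ 2) + (b1 ^ 2 - b2 ^ 2) * (b2 ^ 2 - b3 ^ 2) +
        (b2 ^ 2 - b3 ^ 2) * (b3 ^ 2 - b4 ^ 2) + (b3 ^ 2 - b4 ^ 2) * (b4 ^ 2 - b5 ^ 2) +
        (b4 ^ 2 - b5 ^ 2) * (b5 ^ 2 - b6 ^ 2) + (b5 ^ 2 - b6 ^ 2) * (b6 ^ 2 - t ^ 2)) := by
  have q2 := mul_nonneg (sq_nonneg t) (gap_quadratic_nonneg h1 h2 h3 h4 h5 h6 h7)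
  have q3 := mul_nonneg ht (gap_cubic_nonneg h1 h2 h3 h4 h5 h6 h7)
  have q4 := sum_gap_pow_four_le h1 h2 h3 h4 h5 h6 h7
  subst e6 e5 e4 e3 e2 e1 e0 hs
  linear_combination (1 / 100) * q2 + (1 / 100) * q3 + (1 / 100) * q4

theorem exists_weighted_variance_le_of_antitone {b : Fin 8 → ℝ} (hb : Antitone b)
    (h0 : ∀ i, 0 ≤ b i) : ∃ s, ∑ j, b j ^ 2 * (b j - s) ^ 2 +
      (∑ k : Fin 7, (b k.castSucc - b k.succ) ^ 4) / 100 ≤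
      ∑ k : Fin 7, (b k.castSucc ^ 2 - b k.succ ^ 2) ^ 2 +
        ∑ k : Fin 6, (b k.castSucc.castSucc ^ 2 - b k.castSucc.succ ^ 2) *
          (b k.succ.castSucc ^ 2 - b k.succ.succ ^ 2) := by
  have hgap : ∀ k : Fin 7, 0 ≤ b k.castSucc - b k.succ := fun k =>
    sub_nonneg.2 (hb (Fin.castSucc_lt_succ (i := k)).le)
  refine ⟨(2 * b 0 + 2 * b 1 + b 2 + b 3 + b 4 + b 5 + b 6 + b 7) / 10, ?_⟩
  have h := weighted_variance_add_gaps_le (h0 7) (hgap 0) (hgap 1) (hgap 2) (hgap 3) (hgap 4)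
    (hgap 5) (hgap 6) (b6 := b 6) (b5 := b 5) (b4 := b 4) (b3 := b 3) (b2 := b 2) (b1 := b 1)
    (b0 := b 0) (add_sub_cancel _ _).symm (add_sub_cancel _ _).symm (add_sub_cancel _ _).symm
    (add_sub_cancel _ _).symm (add_sub_cancel _ _).symm (add_sub_cancel _ _).symm
    (add_sub_cancel _ _).symm rfl
  simp only [Fin.sum_univ_six, Fin.sum_univ_seven, Fin.sum_univ_eight]
  exact h

theorem exists_weighted_variance_le_energy {a : Fin 8 → ℝ} (h0 : ∀ i, 0 ≤ a i) :
    ∃ s, ∑ i, a i ^ 2 * (a i - s) ^ 2 ≤ (∑ i, (a i ^ 2 - a (i + 1) ^ 2) ^ 2) / 2 ∧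
      (∑ i, a i ^ 2 * (a i - s) ^ 2 = (∑ i, (a i ^ 2 - a (i + 1) ^ 2) ^ 2) / 2 →
        ∀ i j, a i = a j) := by
  -- The negation sorts in decreasing order, so that rank 0 is the largest value.
  set σ := Tuple.sort (fun i => - a i)
  set b : Fin 8 → ℝ := fun j => a (σ j) with hbdef
  have hb : Antitone b := fun i j hij =>
    neg_le_neg_iff.1 (Tuple.monotone_sort (fun i => - a i) hij)
  have hb0 : ∀ j, 0 ≤ b j := fun j => h0 _
  have hab : ∀ i, a i = b (σ.symm i) := fun i => by simp [hbdef]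
  obtain ⟨s, hs⟩ := exists_weighted_variance_le_of_antitone hb hb0
  have henergy := cyclic_dirichlet_energy_ge (p := fun j => b j ^ 2)
    (fun i j hij => pow_le_pow_left₀ (hb0 j) (hb hij) 2) σ.symm
  have hvar : ∑ i, a i ^ 2 * (a i - s) ^ 2 = ∑ j, b j ^ 2 * (b j - s) ^ 2 :=
    (Equiv.sum_comp σ fun i => a i ^ 2 * (a i - s) ^ 2).symm
  simp only [← hab] at henergy
  have hgap0 : 0 ≤ ∑ k : Fin 7, (b k.castSucc - b k.succ) ^ 4 :=
    Finset.sum_nonneg fun k _ => by positivity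
  refine ⟨s, by rw [hvar]; linarith, fun heq => ?_⟩
  have hgap : ∑ k : Fin 7, (b k.castSucc - b k.succ) ^ 4 = 0 := by
    rw [hvar] at heq
    linarith
  rw [Finset.sum_eq_zero_iff_of_nonneg fun k _ => by positivity] at hgap
  have hstep : ∀ k : Fin 7, b k.succ = b k.castSucc := fun k =>
    (sub_eq_zero.1 (pow_eq_zero_iff (by norm_num) |>.1 (hgap k (Finset.mem_univ k)))).symm
  have hconst : ∀ j, b j = b 0 := by
    intro j
    induction j using Fin.induction with
    | zero => rfl
    | succ k ih => rw [hstep, ih]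
  intro i j
  rw [hab i, hab j, hconst, hconst (σ.symm j)]

theorem exists_weighted_variance_le_energy_of_le_eight (n : ℕ) [NeZero n] (hn : n ≤ 8)
    {x : Fin n → ℝ} (h0 : ∀ i, 0 ≤ x i) :
    ∃ s, ∑ i, x i ^ 2 * (x i - s) ^ 2 ≤ (∑ i, (x i ^ 2 - x (i + 1) ^ 2) ^ 2) / 2 ∧
      (∑ i, x i ^ 2 * (x i - s) ^ 2 = (∑ i, (x i ^ 2 - x (i + 1) ^ 2) ^ 2) / 2 →
        ∀ i j, x i = x j) := by
  have hpos : 0 < n := Nat.pos_of_neZero n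
  -- Repeating the last entry adds only zero steps to the energy, and the closing step still joins
  -- the last entry to the first; the variance can only grow.
  let f : Fin 8 → Fin n := fun j => ⟨min j (n - 1), by omega⟩
  have hf : ∀ i : Fin n, f ⟨i, by omega⟩ = i := fun i => Fin.ext (by simp [f]; omega)
  obtain ⟨s, hle, heq⟩ := exists_weighted_variance_le_energy (a := fun j => x (f j))
    fun j => h0 (f j)
  have hlast : 0 ≤ x (f 7) ^ 2 * (x (f 7) - s) ^ 2 := by positivity
  have hE : ∑ i, (x (f i) ^ 2 - x (f (i + 1)) ^ 2) ^ 2 = ∑ i, (x i ^ 2 - x (i + 1) ^ 2) ^ 2 := by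
    clear hle heq hlast hf h0
    interval_cases n <;> simp [Fin.sum_univ_succ, f]
  have hV : ∑ i, x i ^ 2 * (x i - s) ^ 2 ≤ ∑ j, x (f j) ^ 2 * (x (f j) - s) ^ 2 := by
    have hinj : Function.Injective (fun i : Fin n => (⟨i, by omega⟩ : Fin 8)) := fun i j h =>
      Fin.ext (by simpa using h)
    calc ∑ i, x i ^ 2 * (x i - s) ^ 2
        = ∑ j ∈ Finset.univ.map ⟨_, hinj⟩, x (f j) ^ 2 * (x (f j) - s) ^ 2 := by
          rw [Finset.sum_map]
          exact Finset.sum_congr rfl fun i _ => by simp only [Function.Embedding.coeFn_mk, hf]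
      _ ≤ _ := Finset.sum_le_sum_of_subset_of_nonneg (Finset.subset_univ _)
          fun j _ _ => by positivity
  refine ⟨s, by linarith, fun h i j => ?_⟩
  have := heq (by linarith) ⟨i, by omega⟩ ⟨j, by omega⟩
  simpa only [hf] using this

/-! ### The inequality and its equality case -/

theorem sum_sq_mul_sum_le_sq_sum_cube {n : ℕ} [NeZero n] (hn : n ≤ 8) {x : Fin n → ℝ}
    (h0 : ∀ i, 0 ≤ x i) :
    (∑ i, x i ^ 2) * (∑ i, x i ^ 2 * x (i + 1) ^ 2) ≤ (∑ i, x i ^ 3) ^ 2 ∧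
      ((∑ i, x i ^ 3) ^ 2 = (∑ i, x i ^ 2) * (∑ i, x i ^ 2 * x (i + 1) ^ 2) ↔
        ∀ i j, x i = x j) := by
  obtain ⟨s, hle, heq⟩ := exists_weighted_variance_le_energy_of_le_eight n hn h0
  set A := ∑ i, x i ^ 2 with hA
  set B := ∑ i, x i ^ 3 with hB
  set C := ∑ i, x i ^ 2 * x (i + 1) ^ 2 with hC
  have hA0 : 0 ≤ A := Finset.sum_nonneg fun i _ => by positivity
  have hV : ∑ i, x i ^ 2 * (x i - s) ^ 2 = ∑ i, x i ^ 4 - 2 * s * B + s ^ 2 * A := by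
    rw [hA, hB, Finset.mul_sum, Finset.mul_sum, ← Finset.sum_sub_distrib, ← Finset.sum_add_distrib]
    exact Finset.sum_congr rfl fun i _ => by ring
  have hE : (∑ i, (x i ^ 2 - x (i + 1) ^ 2) ^ 2) / 2 = ∑ i, x i ^ 4 - C := by
    have hshift : ∑ i, x (i + 1) ^ 4 = ∑ i, x i ^ 4 :=
      Equiv.sum_comp (Equiv.addRight (1 : Fin n)) fun i => x i ^ 4
    have : ∑ i, (x i ^ 2 - x (i + 1) ^ 2) ^ 2 = ∑ i, x i ^ 4 + ∑ i, x (i + 1) ^ 4 - 2 * C := by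
      rw [hC, Finset.mul_sum, ← Finset.sum_add_distrib, ← Finset.sum_sub_distrib]
      exact Finset.sum_congr rfl fun i _ => by ring
    rw [this, hshift]
    ring
  rw [hV, hE] at hle heq
  have hC' : C ≤ 2 * s * B - s ^ 2 * A := by linarith
  have hAC := mul_le_mul_of_nonneg_left hC' hA0
  have hsq := sq_nonneg (B - s * A)
  refine ⟨by nlinarith, fun h => ?_, fun h => ?_⟩
  · rcases hA0.eq_or_lt with hA1 | hA1
    · have hz : ∀ i, x i = 0 := fun i => by
        have := (Finset.sum_eq_zero_iff_of_nonneg fun i _ => by positivity).1 hA1.symm i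
          (Finset.mem_univ i)
        exact pow_eq_zero_iff (by norm_num) |>.1 this
      intro i j
      rw [hz i, hz j]
    · refine heq ?_
      -- Under equality `A * C = B ^ 2`, so this is again `0 ≤ (B - s * A) ^ 2`; cancelling `A`
      -- makes the variance bound an equality.
      have : A * (2 * s * B - s ^ 2 * A) ≤ A * C := by nlinarith
      have := le_of_mul_le_mul_left this hA1
      linarith
  · have hc : ∀ i, x i = x 0 := fun i => h i 0
    rw [hA, hB, hC]
    simp only [hc, Finset.sum_const, Finset.card_univ, Fintype.card_fin, nsmul_eq_mul]
    ring

/-! ### Counterexamples for more than eight variables -/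

/-- The nonagon counterexample. -/
theorem sq_sum_cube_lt_nonagon {b : ℕ → ℝ} (e0 : b 0 = √(17 / 2)) (e1 : b 1 = √9)
    (e2 : b 2 = √10) (e3 : b 3 = √(23 / 2)) (e4 : b 4 = √12) (e5 : b 5 = √(23 / 2))
    (e6 : b 6 = √10) (e7 : b 7 = √9) (e8 : b 8 = √(17 / 2)) (e9 : b 9 = √(17 / 2)) :
    (∑ i ∈ Finset.range 9, b i ^ 3) ^ 2 <
      (∑ i ∈ Finset.range 9, b i ^ 2) * ∑ i ∈ Finset.range 9, b i ^ 2 * b (i + 1) ^ 2 := by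
  have cube : ∀ r : ℝ, 0 ≤ r → √r ^ 3 = r * √r := fun r hr => by
    rw [pow_succ, Real.sq_sqrt hr]
  have h1 : √(17 / 2 : ℝ) ≤ 2.91547595 := Real.sqrt_le_iff.2 (by norm_num)
  have h2 : √(9 : ℝ) ≤ 3 := Real.sqrt_le_iff.2 (by norm_num)
  have h3 : √(10 : ℝ) ≤ 3.16227767 := Real.sqrt_le_iff.2 (by norm_num)
  have h4 : √(23 / 2 : ℝ) ≤ 3.39116500 := Real.sqrt_le_iff.2 (by norm_num)
  have h5 : √(12 : ℝ) ≤ 3.46410162 := Real.sqrt_le_iff.2 (by norm_num)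
  simp only [Finset.sum_range_succ, Finset.sum_range_zero, Nat.reduceAdd, e0, e1, e2, e3, e4, e5,
    e6, e7, e8, e9, zero_add]
  rw [cube _ (by norm_num), cube _ (by norm_num), cube _ (by norm_num), cube _ (by norm_num),
    cube _ (by norm_num), Real.sq_sqrt (by norm_num), Real.sq_sqrt (by norm_num),
    Real.sq_sqrt (by norm_num), Real.sq_sqrt (by norm_num), Real.sq_sqrt (by norm_num)]
  -- The margin is thin: the sum of cubes is about 286.3747, while the right side is `82012.5`, the
  -- square of about 286.378.
  refine (pow_lt_pow_left₀ (b := 286.377) (by linarith) (by positivity) (by norm_num)).trans ?_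
  norm_num

/-- Appending `m` copies of `c` preserves a strict failure: the `m ^ 2` terms agree on both sides,
and the terms linear in `m` compare by AM-GM, since `S ^ 2 < T * K`. -/
theorem add_const_sq_sum_cube_lt {S T K c m : ℝ} (hT : 0 ≤ T) (hK : 0 ≤ K)
    (hc : 0 ≤ c) (hm : 0 ≤ m) (h : S ^ 2 < T * K) :
    (S + m * c ^ 3) ^ 2 < (T + m * c ^ 2) * (K + m * (c ^ 2 * c ^ 2)) := by
  have h1 : 2 * (S * c ^ 3) ≤ c ^ 2 * K + c ^ 4 * T := by
    refine le_of_sq_le_sq ?_ (by positivity)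
    nlinarith [sq_nonneg (c ^ 2 * K - c ^ 4 * T), mul_le_mul_of_nonneg_left h.le (pow_nonneg hc 6)]
  nlinarith [mul_le_mul_of_nonneg_left h1 hm]

theorem exists_counterexample_of_eight_lt {n : ℕ} [NeZero n] (hn : 8 < n) :
    ∃ x : Fin n → ℝ, (∀ i, 0 ≤ x i) ∧
      (∑ i, x i ^ 3) ^ 2 < (∑ i, x i ^ 2) * (∑ i, x i ^ 2 * x (i + 1) ^ 2) := by
  let b : ℕ → ℝ := fun k =>
    if k = 1 ∨ k = 7 then √9 else if k = 2 ∨ k = 6 then √10 else if k = 3 ∨ k = 5 then √(23 / 2)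
    else if k = 4 then √12 else √(17 / 2)
  have hb0 : ∀ k, 0 ≤ b k := fun k => by simp only [b]; split_ifs <;> positivity
  have hb : ∀ k, b (9 + k) = √(17 / 2) := fun k => by
    simp only [b]
    rw [if_neg (by omega), if_neg (by omega), if_neg (by omega), if_neg (by omega)]
  -- The sequence starts with the value that fills its tail, so wrapping around agrees with reading
  -- `b` one place further.
  have hbn : b n = b 0 := by
    obtain ⟨k, rfl⟩ := Nat.exists_eq_add_of_le (show 9 ≤ n from hn)
    rw [hb]
    simp [b]
  have hnext : ∀ i : Fin n, b (i + 1 : Fin n).val = b (i.val + 1) := by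
    intro i
    rw [Fin.val_add, Fin.val_one', Nat.add_mod_mod]
    rcases (Nat.succ_le_of_lt i.isLt).eq_or_lt with h | h
    · rw [show i.val + 1 = n from h, Nat.mod_self, hbn]
    · rw [Nat.mod_eq_of_lt h]
  refine ⟨fun i => b i, fun i => hb0 i, ?_⟩
  simp only [hnext]
  rw [Fin.sum_univ_eq_sum_range (fun i => b i ^ 3), Fin.sum_univ_eq_sum_range (fun i => b i ^ 2),
    Fin.sum_univ_eq_sum_range (fun i => b i ^ 2 * b (i + 1) ^ 2)]
  obtain ⟨m, rfl⟩ := Nat.exists_eq_add_of_le (show 9 ≤ n from hn)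
  simp only [Finset.sum_range_add, hb, add_assoc 9, Finset.sum_const, Finset.card_range,
    nsmul_eq_mul]
  refine add_const_sq_sum_cube_lt (Finset.sum_nonneg fun i _ => by positivity)
    (Finset.sum_nonneg fun i _ => by positivity) (Real.sqrt_nonneg _) (Nat.cast_nonneg m)
    (sq_sum_cube_lt_nonagon ?_ ?_ ?_ ?_ ?_ ?_ ?_ ?_ ?_ ?_) <;> simp [b]

theorem theorem2 :
    (∀ (n : ℕ) [NeZero n], n ≤ 8 → ∀ x : Fin n → ℝ, (∀ i, 0 ≤ x i) →
      (∑ i, x i ^ 2) * (∑ i, x i ^ 2 * x (i + 1) ^ 2) ≤ (∑ i, x i ^ 3) ^ 2 ∧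
      ((∑ i, x i ^ 3) ^ 2 = (∑ i, x i ^ 2) * (∑ i, x i ^ 2 * x (i + 1) ^ 2) ↔
        ∀ i j, x i = x j)) ∧
    (∀ (n : ℕ) [NeZero n], 8 < n → ∃ x : Fin n → ℝ, (∀ i, 0 ≤ x i) ∧
      (∑ i, x i ^ 3) ^ 2 < (∑ i, x i ^ 2) * (∑ i, x i ^ 2 * x (i + 1) ^ 2)) ∧
    (∀ x : Fin 9 → ℝ,
      x = ![√(17 / 2), √9, √10, √(23 / 2), √12, √(23 / 2), √10, √9, √(17 / 2)] →
      (∑ i, x i ^ 3) ^ 2 < (∑ i, x i ^ 2) * (∑ i, x i ^ 2 * x (i + 1) ^ 2)) := by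
  refine ⟨fun n _ hn x h0 => sum_sq_mul_sum_le_sq_sum_cube hn h0,
    fun n _ hn => exists_counterexample_of_eight_lt hn, ?_⟩
  rintro x rfl
  -- The default of `getD` supplies `b 9`, the wrapped-around first entry.
  have h := sq_sum_cube_lt_nonagon
    (b := fun k => [√(17 / 2), √9, √10, √(23 / 2), √12, √(23 / 2), √10, √9, √(17 / 2)].getD k
      √(17 / 2)) rfl rfl rfl rfl rfl rfl rfl rfl rfl rfl
  simpa [Fin.sum_univ_succ, Finset.sum_range_succ, add_assoc] using h
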